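/- Let $H$ be a regular hexagon with side length $2$ in the Euclidean plane, with center $c$, and let $c+2u$ (with $|u|=1$) be one of its vertices. Let $A$ be the rhombus whose vertices are $c+2u$, the midpoints of the two sides of $H$ that meet at $c+2u$, and $c+u$; it has side length $1$ and acute angle $\pi/3$. Consider the regular hexagon with side length $1$ and center $c-u$ that has $c-2u$ as a vertex; let $L$ be the rhombus (again with side length $1$ and acute angle $\pi/3$) whose vertices are its center $c-u$, its vertex $c-2u$ and the two vertices adjacent to $c-2u$. (So $A$ and $L$ lie at opposite corners of $H$ and are symmetric about $c$.) Let $X$ and $Y$ be independent random points, uniformly distributed in $A$ and in $L$ respectively. Then the law of the Euclidean distance $|X-Y|$ is absolutely continuous on $\mathbb{R}$ and has as a density the nonnegative function $f_{D_8}(d)=2d\,g(d)$, where $$ g(d)=\begin{cases} -\frac{2}{\sqrt3}\left(\frac{d^2}{3}+4\right)\sin^{-1}\frac{\sqrt3}{d}+\left(\frac13+\frac{2\pi}{9\sqrt3}\right)d^2-\frac{10}{3}\sqrt{d^2-3}+\frac{8\pi}{3\sqrt3}+2, & 2\le d\le\sqrt7,\\[1ex] \frac{2}{\sqrt3}\left(\frac{d^2}{3}+8\right)\sin^{-1}\frac{\sqrt3}{d}+\frac{4}{\sqrt3}\left(\frac{d^2}{3}+6\right)\sin^{-1}\frac{3\sqrt3}{2d}-\left(1+\frac{2\pi}{3\sqrt3}\right)d^2+6\sqrt{d^2-3}+\frac{11}{3}\sqrt{4d^2-27}-\frac{40\pi}{3\sqrt3}-11,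 & \sqrt7< d\le 3,\\[1ex] \frac{2}{\sqrt3}\left(\frac{d^2}{3}+8\right)\sin^{-1}\frac{\sqrt3}{d}-\frac{4}{\sqrt3}\left(\frac{d^2}{3}+12\right)\sin^{-1}\frac{3\sqrt3}{2d}+\left(\frac13+\frac{2\pi}{9\sqrt3}\right)d^2+6\sqrt{d^2-3}-\frac{19}{3}\sqrt{4d^2-27}+\frac{32\pi}{3\sqrt3}+7, & 3< d\le 2\sqrt3,\\[1ex] -\frac{4}{\sqrt3}\left(\frac{d^2}{3}+12\right)\sin^{-1}\frac{3\sqrt3}{2d}-\frac{2}{\sqrt3}\left(\frac{d^2}{3}+8\right)\sin^{-1}\frac{2\sqrt3}{d}+\left(1+\frac{2\pi}{3\sqrt3}\right)d^2-\frac{19}{3}\sqrt{4d^2-27}-4\sqrt{d^2-12}+\frac{64\pi}{3\sqrt3}+17, & 2\sqrt3< d\le\sqrt{13},\\[1ex] \frac{2}{\sqrt3}\left(\frac{d^2}{3}+16\right)\sin^{-1}\frac{2\sqrt3}{d}-\left(\frac13+\frac{2\pi}{9\sqrt3}\right)d^2+\frac{20}{3}\sqrt{d^2-12}-\frac{32\pi}{3\sqrt3}-8,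 & \sqrt{13}< d\le 4,\\[1ex] 0, & \text{otherwise.} \end{cases} $$ -/

import Mathlib

noncomputable section

/-- The vertices `c + w * exp (k * π * I / 3)`, `k = 0, …, 5` (indices modulo 6), of the regular
hexagon in the plane `ℂ` with center `c` and side length `‖w‖` that has `c + w` as a vertex. -/
def hexVertex (c w : ℂ) (k : ℤ) : ℂ :=
  c + w * Complex.exp (((k : ℝ) * Real.pi / 3 : ℝ) * Complex.I)

/-- For `‖u‖ = 1`: the unit rhombus `A` at the corner `c + 2u` of the regular hexagon with
center `c`, side length `2` and a vertex at `c + 2u`. Its vertices are this corner, the midpoints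
of the two sides of the hexagon that meet there, and `c + u`. -/
def rhombusA (c u : ℂ) : Set ℂ :=
  convexHull ℝ {hexVertex c (2 * u) 0,
    midpoint ℝ (hexVertex c (2 * u) 0) (hexVertex c (2 * u) 1),
    c + u,
    midpoint ℝ (hexVertex c (2 * u) 0) (hexVertex c (2 * u) (-1))}

/-- For `‖u‖ = 1`: the unit rhombus `L`. The part of the hexagon with center `c`, side length `2`
and vertex `c + 2u` that is opposite to the corner `c + 2u` is the unit hexagon with center `c - u`
and vertex `c - 2u`. It is cut into three rhombuses by segments from its center to
every other vertex, and `L` is the one of them that contains the vertex `c - 2u`, the corner of the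
large hexagon opposite to the one in `rhombusA c u`. -/
def rhombusL (c u : ℂ) : Set ℂ :=
  convexHull ℝ {c - u,
    hexVertex (c - u) (-u) (-1),
    hexVertex (c - u) (-u) 0,
    hexVertex (c - u) (-u) 1}

/-- The explicit five-piece function on `[2, 4]`, zero elsewhere. -/
def densityAL (d : ℝ) : ℝ :=
  2 * d *
    (if d < 2 then 0
    else if d ≤ √7 then
      -(2 / √3) * (d ^ 2 / 3 + 4) * Real.arcsin (√3 / d)
        + (1 / 3 + 2 * Real.pi / (9 * √3)) * d ^ 2
        - 10 / 3 * √(d ^ 2 - 3) + 8 * Real.pi / (3 * √3) + 2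
    else if d ≤ 3 then
      2 / √3 * (d ^ 2 / 3 + 8) * Real.arcsin (√3 / d)
        + 4 / √3 * (d ^ 2 / 3 + 6) * Real.arcsin (3 * √3 / (2 * d))
        - (1 + 2 * Real.pi / (3 * √3)) * d ^ 2
        + 6 * √(d ^ 2 - 3) + 11 / 3 * √(4 * d ^ 2 - 27)
        - 40 * Real.pi / (3 * √3) - 11
    else if d ≤ 2 * √3 then
      2 / √3 * (d ^ 2 / 3 + 8) * Real.arcsin (√3 / d)
        - 4 / √3 * (d ^ 2 / 3 + 12) * Real.arcsin (3 * √3 / (2 * d))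
        + (1 / 3 + 2 * Real.pi / (9 * √3)) * d ^ 2
        + 6 * √(d ^ 2 - 3) - 19 / 3 * √(4 * d ^ 2 - 27)
        + 32 * Real.pi / (3 * √3) + 7
    else if d ≤ √13 then
      -(4 / √3) * (d ^ 2 / 3 + 12) * Real.arcsin (3 * √3 / (2 * d))
        - 2 / √3 * (d ^ 2 / 3 + 8) * Real.arcsin (2 * √3 / d)
        + (1 + 2 * Real.pi / (3 * √3)) * d ^ 2
        - 19 / 3 * √(4 * d ^ 2 - 27) - 4 * √(d ^ 2 - 12)
        + 64 * Real.pi / (3 * √3) + 17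
    else if d ≤ 4 then
      2 / √3 * (d ^ 2 / 3 + 16) * Real.arcsin (2 * √3 / d)
        - (1 / 3 + 2 * Real.pi / (9 * √3)) * d ^ 2
        + 20 / 3 * √(d ^ 2 - 12) - 32 * Real.pi / (3 * √3) - 8
    else 0)

end

open MeasureTheory Set

/-! In the basis $u e^{\pm i\pi/3}$ the rhombus $A$ is $c+u$ plus the unit square, and $L$ is $c-u$
minus it. With $U,V$ the independent uniform coordinates, $X-Y$ therefore has coordinates
$(2,2)+U+V$. These are independent, each with density `tent`, and $|X-Y|^2=a^2-ab+b^2$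
(`lintegral_add_of_uniform_square`, `norm_obliqueMap`).

The coordinate change has Jacobian $2/\sqrt3$, so in polar coordinates the density at $d>0$ is
$\frac{2d}{\sqrt3}$ times the integral of `tent a * tent b` over the angle on the circle of radius
$d$ (`lintegral_tent_mul_norm`).

Since `tent` is the second difference $(x-2)_+-2(x-3)_++(x-4)_+$, this integral is a weighted sum of
nine integrals of $(a-i)_+(b-j)_+$ with $i,j\in\{2,3,4\}$ (`integral_tent_mul_tent`). Each vanishes
until the disk reaches the corner $(i,j)$, and is elementary afterwards (`quadrantIntegral_eq_zero`,
`quadrantIntegral_eq_formula`). The squared norms $4,7,9,12,13,16$ of the corners are the squared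
breakpoints of the density. -/

/-- The density of `p + q + 2` for independent `p` and `q` that are uniform on `[0, 1]`. -/
noncomputable def tent (x : ℝ) : ℝ := max 0 (min 1 (x - 2) - max 0 (x - 3))

lemma tent_nonneg (x : ℝ) : 0 ≤ tent x := le_max_left _ _

lemma continuous_tent : Continuous tent := by unfold tent; fun_prop

lemma tent_eq_sum_posPart (x : ℝ) :
    tent x = max 0 (x - 2) - 2 * max 0 (x - 3) + max 0 (x - 4) := by
  unfold tent
  rcases le_total x 2 with h2 | h2 <;> rcases le_total x 3 with h3 | h3 <;>
    rcases le_total x 4 with h4 | h4 <;>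
    first
    | (exfalso; linarith)
    | (simp only [max_def, min_def]; split_ifs <;> linarith)

/-! ### Oblique coordinates along a circle -/

lemma sqrt_three_sq : √3 ^ 2 = (3 : ℝ) := Real.sq_sqrt (by norm_num)

lemma sqrt_three_pos : 0 < √(3 : ℝ) := by positivity

lemma div_sqrt_three (x : ℝ) : x / √3 = x * √3 / 3 := by
  have := sqrt_three_pos.ne'
  field_simp
  linear_combination (-x) * sqrt_three_sq

/-- The first coordinate `x + y / √3` of the point `(x, y)` with polar coordinates `(r, θ)` with
respect to the basis `exp (π * I / 3)`, `exp (-π * I / 3)` of the plane. -/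
noncomputable def obliqueFst (r θ : ℝ) : ℝ := r * Real.cos θ + r * Real.sin θ / √3

/-- The second coordinate of the point with polar coordinates `(r, θ)`; see `obliqueFst`. -/
noncomputable def obliqueSnd (r θ : ℝ) : ℝ := r * Real.cos θ - r * Real.sin θ / √3

lemma obliqueFst_eq (r θ : ℝ) : obliqueFst r θ = 2 * r / √3 * Real.sin (Real.pi / 3 + θ) := by
  have := sqrt_three_sq
  rw [Real.sin_add, Real.sin_pi_div_three, Real.cos_pi_div_three, obliqueFst]
  field_simp

lemma obliqueSnd_eq_obliqueFst_neg (r θ : ℝ) : obliqueSnd r θ = obliqueFst r (-θ) := by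
  simp only [obliqueSnd, obliqueFst, Real.cos_neg, Real.sin_neg]; ring

lemma oblique_norm_sq (r θ : ℝ) :
    obliqueFst r θ ^ 2 - obliqueFst r θ * obliqueSnd r θ + obliqueSnd r θ ^ 2 = r ^ 2 := by
  have h := sqrt_three_sq
  have h2 := Real.sin_sq_add_cos_sq θ
  have h3 := sqrt_three_pos.ne'
  simp only [obliqueFst, obliqueSnd]
  field_simp
  linear_combination (r ^ 2 * Real.cos θ ^ 2 - r ^ 2) * h + 3 * r ^ 2 * h2

lemma continuous_obliqueFst (r : ℝ) : Continuous (obliqueFst r) := by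
  unfold obliqueFst; fun_prop

lemma continuous_obliqueSnd (r : ℝ) : Continuous (obliqueSnd r) := by
  unfold obliqueSnd; fun_prop

/-! ### Circle integrals over a quadrant -/

/-- The integral over the circle of radius `r` of the product of the truncated coordinates. -/
noncomputable def quadrantIntegral (i j r : ℝ) : ℝ :=
  ∫ θ in (-Real.pi)..Real.pi, max 0 (obliqueFst r θ - i) * max 0 (obliqueSnd r θ - j)

/-- The first oblique coordinate equals `i` at the point with polar coordinates
`(r, cutAngle i r - π / 3)`. -/
noncomputable def cutAngle (i r : ℝ) : ℝ := Real.arcsin (i * √3 / (2 * r))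

/-- The value of `quadrantIntegral` when the corner of the quadrant is in the disk. -/
noncomputable def quadrantFormula (i j r : ℝ) : ℝ :=
  (r ^ 2 / 3 + i * j) * (2 * Real.pi / 3 - cutAngle i r - cutAngle j r) +
    √3 * (r ^ 2 / 3 + (i ^ 2 + j ^ 2) / 4
      - (i * √(4 * r ^ 2 - 3 * i ^ 2) + j * √(4 * r ^ 2 - 3 * j ^ 2)) / 12
      - (j * √(4 * r ^ 2 - 3 * i ^ 2) + i * √(4 * r ^ 2 - 3 * j ^ 2)) / 3)

/-- The conditions `i ≤ 2 * j` and `j ≤ 2 * i` make the gradient $(2i-j,2j-i)$ of the quadratic form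
nonnegative at the corner, so the corner is the point of the quadrant nearest to the origin. -/
lemma quadrantIntegral_eq_zero {i j r : ℝ} (hij : i ≤ 2 * j) (hji : j ≤ 2 * i)
    (h : r ^ 2 ≤ i ^ 2 - i * j + j ^ 2) : quadrantIntegral i j r = 0 := by
  unfold quadrantIntegral
  refine (intervalIntegral.integral_congr fun θ _ => ?_).trans intervalIntegral.integral_zero
  have h1 := oblique_norm_sq r θ
  rcases le_or_gt (obliqueFst r θ) i with ha | ha
  · rw [max_eq_left (by linarith), zero_mul]
  rcases le_or_gt (obliqueSnd r θ) j with hb | hb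
  · rw [max_eq_left (b := obliqueSnd r θ - j) (by linarith), mul_zero]
  exfalso
  generalize obliqueFst r θ = a at *
  generalize obliqueSnd r θ = b at *
  nlinarith [mul_nonneg (sub_nonneg.2 hji) (sub_pos.2 ha).le,
    mul_nonneg (sub_nonneg.2 hij) (sub_pos.2 hb).le, mul_pos (sub_pos.2 ha) (sub_pos.2 hb),
    sq_nonneg ((a - i) - (b - j))]

lemma cutAngle_mem {i r : ℝ} (hi : 0 ≤ i) (hr : 0 < r) :
    cutAngle i r ∈ Icc 0 (Real.pi / 2) :=
  ⟨Real.arcsin_nonneg.2 (by positivity), Real.arcsin_le_pi_div_two _⟩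

lemma sin_cutAngle {i r : ℝ} (hi : 0 ≤ i) (hr : 0 < r) (h : 3 * i ^ 2 ≤ 4 * r ^ 2) :
    Real.sin (cutAngle i r) = i * √3 / (2 * r) := by
  refine Real.sin_arcsin (le_trans (by norm_num) (show (0 : ℝ) ≤ _ by positivity)) ?_
  rw [div_le_one (by positivity)]
  refine abs_le_of_sq_le_sq' ?_ (by positivity) |>.2
  rw [mul_pow, sqrt_three_sq]; linarith

lemma cos_cutAngle {i r : ℝ} (hr : 0 < r) :
    Real.cos (cutAngle i r) = √(4 * r ^ 2 - 3 * i ^ 2) / (2 * r) := by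
  have : 1 - (i * √3 / (2 * r)) ^ 2 = (4 * r ^ 2 - 3 * i ^ 2) / (2 * r) ^ 2 := by
    have := sqrt_three_sq
    rw [div_pow, mul_pow, this]
    field_simp
    ring
  rw [cutAngle, Real.cos_arcsin, this, Real.sqrt_div' _ (by positivity),
    Real.sqrt_sq (by positivity)]

/-- These inequalities order the endpoints of the arcs $a\ge i$ and $b\ge j$, so that the arcs meet
exactly in the interval from `cutAngle i r - π / 3` to `π / 3 - cutAngle j r`. -/
lemma cutAngle_bounds {i j r : ℝ} (hi : 0 ≤ i) (hj : 0 ≤ j) (hr : 0 < r)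
    (h : i ^ 2 - i * j + j ^ 2 ≤ r ^ 2) :
    cutAngle i r ≤ cutAngle j r + Real.pi / 3 ∧
      cutAngle i r + cutAngle j r ≤ 2 * Real.pi / 3 := by
  have hI : 3 * i ^ 2 ≤ 4 * r ^ 2 := by nlinarith [sq_nonneg (i - 2 * j)]
  have hJ : 3 * j ^ 2 ≤ 4 * r ^ 2 := by nlinarith [sq_nonneg (j - 2 * i)]
  obtain ⟨i0, i1⟩ := cutAngle_mem hi hr
  obtain ⟨j0, j1⟩ := cutAngle_mem hj hr
  have key : Real.sin (cutAngle i r) ≤ Real.sin (cutAngle j r + Real.pi / 3) := by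
    rw [Real.sin_add, Real.sin_pi_div_three, Real.cos_pi_div_three, sin_cutAngle hi hr hI,
      sin_cutAngle hj hr hJ, cos_cutAngle hr]
    -- After squaring, this is four times the hypothesis that the corner lies in the disk.
    have : 2 * i - j ≤ √(4 * r ^ 2 - 3 * j ^ 2) :=
      Real.le_sqrt_of_sq_le (by nlinarith)
    have e : j * √3 / (2 * r) * (1 / 2) + √(4 * r ^ 2 - 3 * j ^ 2) / (2 * r) * (√3 / 2)
        - i * √3 / (2 * r) = (√(4 * r ^ 2 - 3 * j ^ 2) - (2 * i - j)) * √3 / (4 * r) := by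
      field_simp; ring
    have : 0 ≤ (√(4 * r ^ 2 - 3 * j ^ 2) - (2 * i - j)) * √3 / (4 * r) := by
      have := sub_nonneg.2 this
      positivity
    linarith
  have hpi := Real.pi_pos
  rcases le_total (cutAngle j r + Real.pi / 3) (Real.pi / 2) with hc | hc
  · have := Real.strictMonoOn_sin.le_iff_le (a := cutAngle i r) (b := cutAngle j r + Real.pi / 3)
      ⟨by linarith, by linarith⟩ ⟨by linarith, by linarith⟩ |>.1 key
    exact ⟨this, by linarith⟩
  · refine ⟨by linarith, ?_⟩
    -- Past $\pi/2$ the sine is no longer increasing; reflecting the angle turns the same comparison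
    -- into the bound on the sum.
    rw [← Real.sin_pi_sub (cutAngle j r + Real.pi / 3)] at key
    have := Real.strictMonoOn_sin.le_iff_le (a := cutAngle i r)
      (b := Real.pi - (cutAngle j r + Real.pi / 3))
      ⟨by linarith, by linarith⟩ ⟨by linarith, by linarith⟩ |>.1 key
    linarith

lemma obliqueFst_le {i r θ : ℝ} (hi : 0 ≤ i) (hr : 0 < r) (h : 3 * i ^ 2 ≤ 4 * r ^ 2)
    (h1 : -Real.pi ≤ θ) (h2 : θ ≤ cutAngle i r - Real.pi / 3) : obliqueFst r θ ≤ i := by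
  obtain ⟨i0, i1⟩ := cutAngle_mem hi hr
  have hpi := Real.pi_pos
  have : Real.sin (Real.pi / 3 + θ) ≤ i * √3 / (2 * r) := by
    rcases le_total (Real.pi / 3 + θ) 0 with h0 | h0
    · exact (Real.sin_nonpos_of_nonpos_of_neg_pi_le h0 (by linarith)).trans (by positivity)
    · rw [← sin_cutAngle hi hr h]
      exact Real.strictMonoOn_sin.monotoneOn ⟨by linarith, by linarith⟩
        ⟨by linarith, by linarith⟩ (by linarith)
  rw [obliqueFst_eq]
  calc _ ≤ 2 * r / √3 * (i * √3 / (2 * r)) := by gcongr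
    _ = i := by field_simp

lemma le_obliqueFst {i r θ : ℝ} (hi : 0 ≤ i) (hr : 0 < r) (h : 3 * i ^ 2 ≤ 4 * r ^ 2)
    (h1 : cutAngle i r - Real.pi / 3 ≤ θ) (h2 : θ ≤ 2 * Real.pi / 3 - cutAngle i r) :
    i ≤ obliqueFst r θ := by
  obtain ⟨i0, i1⟩ := cutAngle_mem hi hr
  have hpi := Real.pi_pos
  have : i * √3 / (2 * r) ≤ Real.sin (Real.pi / 3 + θ) := by
    rw [← sin_cutAngle hi hr h]
    rcases le_total (Real.pi / 3 + θ) (Real.pi / 2) with h0 | h0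
    · exact Real.strictMonoOn_sin.monotoneOn ⟨by linarith, by linarith⟩
        ⟨by linarith, by linarith⟩ (by linarith)
    · rw [← Real.sin_pi_sub (Real.pi / 3 + θ)]
      exact Real.strictMonoOn_sin.monotoneOn ⟨by linarith, by linarith⟩
        ⟨by linarith, by linarith⟩ (by linarith)
  rw [obliqueFst_eq]
  calc i = 2 * r / √3 * (i * √3 / (2 * r)) := by field_simp
    _ ≤ _ := by gcongr

/-- The quadratic part of the integrand is
$r^2(\cos^2\theta-\frac13\sin^2\theta)=r^2(\frac13+\frac23\cos 2\theta)$. -/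
lemma hasDerivAt_oblique_primitive (i j r θ : ℝ) :
    HasDerivAt (fun θ => r ^ 2 * (θ / 3 + 2 / 3 * (Real.sin θ * Real.cos θ))
      - j * (r * (Real.sin θ - Real.cos θ / √3)) - i * (r * (Real.sin θ + Real.cos θ / √3))
      + i * j * θ) ((obliqueFst r θ - i) * (obliqueSnd r θ - j)) θ := by
  have hs := Real.hasDerivAt_sin θ
  have hc := Real.hasDerivAt_cos θ
  have := (((((hasDerivAt_id θ).div_const 3).add ((hs.mul hc).const_mul (2 / 3))).const_mul
    (r ^ 2)).sub (((hs.sub (hc.div_const √3)).const_mul r).const_mul j)).sub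
    (((hs.add (hc.div_const √3)).const_mul r).const_mul i) |>.add
    ((hasDerivAt_id θ).const_mul (i * j))
  refine this.congr_deriv ?_
  have h := sqrt_three_sq
  have h2 := Real.sin_sq_add_cos_sq θ
  simp only [obliqueFst, obliqueSnd, div_sqrt_three]
  linear_combination (-(r ^ 2 / 3)) * h2 + (r ^ 2 * Real.sin θ ^ 2 / 9) * h

lemma integral_oblique_mul {i j r : ℝ} (hi : 0 ≤ i) (hj : 0 ≤ j) (hr : 0 < r)
    (hI : 3 * i ^ 2 ≤ 4 * r ^ 2) (hJ : 3 * j ^ 2 ≤ 4 * r ^ 2) :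
    ∫ θ in (cutAngle i r - Real.pi / 3)..(Real.pi / 3 - cutAngle j r),
      (obliqueFst r θ - i) * (obliqueSnd r θ - j) = quadrantFormula i j r := by
  have hc1 := continuous_obliqueFst r
  have hc2 := continuous_obliqueSnd r
  rw [intervalIntegral.integral_eq_sub_of_hasDerivAt
    (fun θ _ => hasDerivAt_oblique_primitive i j r θ)
    (Continuous.intervalIntegrable (by fun_prop) _ _)]
  have hq := Real.sq_sqrt (sub_nonneg.2 hI)
  have hq' := Real.sq_sqrt (sub_nonneg.2 hJ)
  have h := sqrt_three_sq
  have trig : ∀ {k}, 0 ≤ k → 3 * k ^ 2 ≤ 4 * r ^ 2 →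
      Real.sin (Real.pi / 3 - cutAngle k r) = √3 * (√(4 * r ^ 2 - 3 * k ^ 2) - k) / (4 * r) ∧
      Real.cos (Real.pi / 3 - cutAngle k r) =
        (√(4 * r ^ 2 - 3 * k ^ 2) + 3 * k) / (4 * r) := by
    intro k hk hK
    rw [Real.sin_sub, Real.cos_sub, Real.sin_pi_div_three, Real.cos_pi_div_three,
      sin_cutAngle hk hr hK, cos_cutAngle hr]
    constructor
    · field_simp; ring
    · field_simp; linear_combination (4 * k) * h
  rw [← neg_sub (Real.pi / 3) (cutAngle i r)]
  simp only [Real.sin_neg, Real.cos_neg, (trig hi hI).1, (trig hi hI).2, (trig hj hJ).1,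
    (trig hj hJ).2, quadrantFormula, div_sqrt_three]
  generalize √(4 * r ^ 2 - 3 * i ^ 2) = P at *
  generalize √(4 * r ^ 2 - 3 * j ^ 2) = Q at *
  generalize √3 = s at *
  field_simp
  linear_combination (72 * s) * hq + (72 * s) * hq'

theorem quadrantIntegral_eq_formula {i j r : ℝ} (hi : 0 ≤ i) (hj : 0 ≤ j) (hr : 0 < r)
    (h : i ^ 2 - i * j + j ^ 2 ≤ r ^ 2) : quadrantIntegral i j r = quadrantFormula i j r := by
  have hI : 3 * i ^ 2 ≤ 4 * r ^ 2 := by nlinarith [sq_nonneg (i - 2 * j)]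
  have hJ : 3 * j ^ 2 ≤ 4 * r ^ 2 := by nlinarith [sq_nonneg (j - 2 * i)]
  obtain ⟨i0, i1⟩ := cutAngle_mem hi hr
  obtain ⟨j0, j1⟩ := cutAngle_mem hj hr
  obtain ⟨b1, b2⟩ := cutAngle_bounds hi hj hr h
  obtain ⟨b3, -⟩ := cutAngle_bounds hj hi hr (by linarith)
  have hpi := Real.pi_pos
  have hc1 := continuous_obliqueFst r
  have hc2 := continuous_obliqueSnd r
  have hint : ∀ a b : ℝ, IntervalIntegrable
      (fun θ => max 0 (obliqueFst r θ - i) * max 0 (obliqueSnd r θ - j)) volume a b :=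
    fun a b => Continuous.intervalIntegrable (by fun_prop) _ _
  rw [← integral_oblique_mul hi hj hr hI hJ, quadrantIntegral,
    ← intervalIntegral.integral_add_adjacent_intervals
      (hint _ (cutAngle i r - Real.pi / 3)) (hint _ _),
    ← intervalIntegral.integral_add_adjacent_intervals
      (hint (cutAngle i r - Real.pi / 3) (Real.pi / 3 - cutAngle j r)) (hint _ _)]
  have e1 : ∫ θ in (-Real.pi)..(cutAngle i r - Real.pi / 3),
      max 0 (obliqueFst r θ - i) * max 0 (obliqueSnd r θ - j) = 0 := by
    refine (intervalIntegral.integral_congr fun θ hθ => ?_).trans intervalIntegral.integral_zero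
    rw [uIcc_of_le (by linarith)] at hθ
    have := obliqueFst_le hi hr hI hθ.1 hθ.2
    simp only [max_eq_left (sub_nonpos.2 this), zero_mul]
  -- The reflection $\theta\mapsto-\theta$ exchanges the two coordinates, so the bounds for the
  -- first one serve for the second.
  have e2 : ∫ θ in (Real.pi / 3 - cutAngle j r)..Real.pi,
      max 0 (obliqueFst r θ - i) * max 0 (obliqueSnd r θ - j) = 0 := by
    refine (intervalIntegral.integral_congr fun θ hθ => ?_).trans intervalIntegral.integral_zero
    rw [uIcc_of_le (by linarith)] at hθ
    have := obliqueFst_le (θ := -θ) hj hr hJ (by linarith [hθ.2]) (by linarith [hθ.1])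
    rw [← obliqueSnd_eq_obliqueFst_neg] at this
    simp only [max_eq_left (sub_nonpos.2 this), mul_zero]
  rw [e1, e2, zero_add, add_zero]
  refine intervalIntegral.integral_congr fun θ hθ => ?_
  rw [uIcc_of_le (by linarith)] at hθ
  have h1 := le_obliqueFst hi hr hI hθ.1 (by linarith [hθ.2])
  have h2 := le_obliqueFst (θ := -θ) hj hr hJ (by linarith [hθ.2]) (by linarith [hθ.1])
  rw [← obliqueSnd_eq_obliqueFst_neg] at h2
  simp only [max_eq_right (sub_nonneg.2 h1), max_eq_right (sub_nonneg.2 h2)]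

/-! ### Nine quadrants and the five pieces of the density -/

theorem integral_tent_mul_tent (r : ℝ) :
    ∫ θ in (-Real.pi)..Real.pi, tent (obliqueFst r θ) * tent (obliqueSnd r θ) =
      quadrantIntegral 2 2 r - 2 * quadrantIntegral 2 3 r + quadrantIntegral 2 4 r
      - 2 * (quadrantIntegral 3 2 r - 2 * quadrantIntegral 3 3 r + quadrantIntegral 3 4 r)
      + (quadrantIntegral 4 2 r - 2 * quadrantIntegral 4 3 r + quadrantIntegral 4 4 r) := by
  have hc1 := continuous_obliqueFst r
  have hc2 := continuous_obliqueSnd r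
  have hint : ∀ i j : ℝ, IntervalIntegrable
      (fun θ => max 0 (obliqueFst r θ - i) * max 0 (obliqueSnd r θ - j)) volume
      (-Real.pi) Real.pi :=
    fun a b => Continuous.intervalIntegrable (by fun_prop) _ _
  have row : ∀ i : ℝ, IntervalIntegrable (fun θ =>
      max 0 (obliqueFst r θ - i) * max 0 (obliqueSnd r θ - 2)
      - 2 * (max 0 (obliqueFst r θ - i) * max 0 (obliqueSnd r θ - 3))
      + max 0 (obliqueFst r θ - i) * max 0 (obliqueSnd r θ - 4)) volume (-Real.pi) Real.pi ∧
      ∫ θ in (-Real.pi)..Real.pi, (max 0 (obliqueFst r θ - i) * max 0 (obliqueSnd r θ - 2)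
      - 2 * (max 0 (obliqueFst r θ - i) * max 0 (obliqueSnd r θ - 3))
      + max 0 (obliqueFst r θ - i) * max 0 (obliqueSnd r θ - 4)) =
      quadrantIntegral i 2 r - 2 * quadrantIntegral i 3 r + quadrantIntegral i 4 r := by
    intro i
    refine ⟨((hint i 2).sub ((hint i 3).const_mul 2)).add (hint i 4), ?_⟩
    rw [intervalIntegral.integral_add ((hint i 2).sub ((hint i 3).const_mul 2)) (hint i 4),
      intervalIntegral.integral_sub (hint i 2) ((hint i 3).const_mul 2),
      intervalIntegral.integral_const_mul]
    rfl
  rw [← (row 2).2, ← (row 3).2, ← (row 4).2, ← intervalIntegral.integral_const_mul,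
    ← intervalIntegral.integral_sub (row 2).1 ((row 3).1.const_mul 2),
    ← intervalIntegral.integral_add ((row 2).1.sub ((row 3).1.const_mul 2)) (row 4).1]
  congr 1
  ext θ
  rw [tent_eq_sum_posPart, tent_eq_sum_posPart]
  ring

lemma quadrantFormula_div_sqrt_three (i j r : ℝ) :
    quadrantFormula i j r / √3 =
      (r ^ 2 / 3 + i * j) * (2 * Real.pi / 3 - cutAngle i r - cutAngle j r) / √3 +
      (r ^ 2 / 3 + (i ^ 2 + j ^ 2) / 4
        - (i * √(4 * r ^ 2 - 3 * i ^ 2) + j * √(4 * r ^ 2 - 3 * j ^ 2)) / 12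
        - (j * √(4 * r ^ 2 - 3 * i ^ 2) + i * √(4 * r ^ 2 - 3 * j ^ 2)) / 3) := by
  rw [quadrantFormula, add_div, mul_div_cancel_left₀ _ sqrt_three_pos.ne']

lemma quadrantIntegral_div_of_sq_le {i j r : ℝ} (hij : i ≤ 2 * j) (hji : j ≤ 2 * i)
    (h : r ^ 2 ≤ i ^ 2 - i * j + j ^ 2) : quadrantIntegral i j r / √3 = 0 := by
  rw [quadrantIntegral_eq_zero hij hji h, zero_div]

lemma quadrantIntegral_div_of_le_sq {i j r : ℝ} (hi : 0 ≤ i) (hj : 0 ≤ j) (hr : 0 < r)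
    (h : i ^ 2 - i * j + j ^ 2 ≤ r ^ 2) : quadrantIntegral i j r / √3 =
      (r ^ 2 / 3 + i * j) * (2 * Real.pi / 3 - cutAngle i r - cutAngle j r) / √3 +
      (r ^ 2 / 3 + (i ^ 2 + j ^ 2) / 4
        - (i * √(4 * r ^ 2 - 3 * i ^ 2) + j * √(4 * r ^ 2 - 3 * j ^ 2)) / 12
        - (j * √(4 * r ^ 2 - 3 * i ^ 2) + i * √(4 * r ^ 2 - 3 * j ^ 2)) / 3) := by
  rw [quadrantIntegral_eq_formula hi hj hr h, quadrantFormula_div_sqrt_three]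

/-- On each interval between breakpoints, the corners `(i, j)` inside the disk contribute their
closed formula (`lo`) and the others zero (`up`). -/
theorem densityAL_eq_integral {d : ℝ} (hd : 0 < d) :
    densityAL d = 2 * d *
      ((∫ θ in (-Real.pi)..Real.pi, tent (obliqueFst d θ) * tent (obliqueSnd d θ)) / √3) := by
  have a2 : cutAngle 2 d = Real.arcsin (√3 / d) := by
    rw [cutAngle, mul_div_mul_left _ _ two_ne_zero]
  have a3 : cutAngle 3 d = Real.arcsin (3 * √3 / (2 * d)) := rfl
  have a4 : cutAngle 4 d = Real.arcsin (2 * √3 / d) := by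
    rw [cutAngle, show (4 : ℝ) * √3 = 2 * (2 * √3) by ring, mul_div_mul_left _ _ two_ne_zero]
  have q2 : √(4 * d ^ 2 - 3 * 2 ^ 2) = 2 * √(d ^ 2 - 3) := by
    rw [show 4 * d ^ 2 - 3 * 2 ^ 2 = 2 ^ 2 * (d ^ 2 - 3) by ring, Real.sqrt_mul (by norm_num),
      Real.sqrt_sq (by norm_num)]
  have q3 : √(4 * d ^ 2 - 3 * 3 ^ 2) = √(4 * d ^ 2 - 27) := by norm_num
  have q4 : √(4 * d ^ 2 - 3 * 4 ^ 2) = 2 * √(d ^ 2 - 12) := by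
    rw [show 4 * d ^ 2 - 3 * 4 ^ 2 = 2 ^ 2 * (d ^ 2 - 12) by ring, Real.sqrt_mul (by norm_num),
      Real.sqrt_sq (by norm_num)]
  have up : ∀ i j : ℝ, 2 ≤ i ∧ i ≤ 4 → 2 ≤ j ∧ j ≤ 4 → d ^ 2 ≤ i ^ 2 - i * j + j ^ 2 →
      quadrantIntegral i j d / √3 = 0 := fun i j hi hj h =>
    quadrantIntegral_div_of_sq_le (by linarith) (by linarith) h
  have lo : ∀ i j : ℝ, 2 ≤ i ∧ i ≤ 4 → 2 ≤ j ∧ j ≤ 4 → i ^ 2 - i * j + j ^ 2 ≤ d ^ 2 →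
      quadrantIntegral i j d / √3 = _ := fun i j hi hj h =>
    quadrantIntegral_div_of_le_sq (by linarith) (by linarith) hd h
  have s7 : √(7 : ℝ) ^ 2 = 7 := Real.sq_sqrt (by norm_num)
  have s13 : √(13 : ℝ) ^ 2 = 13 := Real.sq_sqrt (by norm_num)
  have s12 : (2 * √(3 : ℝ)) ^ 2 = 12 := by rw [mul_pow, sqrt_three_sq]; norm_num
  have le_of : ∀ {v : ℝ}, d ≤ v → d ^ 2 ≤ v ^ 2 := fun h => by gcongr
  have lt_of : ∀ {v : ℝ}, 0 ≤ v → ¬ d ≤ v → v ^ 2 ≤ d ^ 2 := fun h0 h => by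
    have := (not_le.1 h).le
    gcongr
  rw [integral_tent_mul_tent, densityAL]
  congr 1
  simp only [add_div, sub_div, mul_div_assoc]
  split_ifs with h2 h7 h3 h12 h13 h4
  · have := le_of h2.le
    rw [up 2 2, up 2 3, up 2 4, up 3 2, up 3 3, up 3 4, up 4 2, up 4 3, up 4 4] <;>
      first | (constructor <;> norm_num) | linarith
  · have := le_of h7
    rw [s7] at this
    have h2 : (2 : ℝ) ^ 2 ≤ d ^ 2 := by have := not_lt.1 h2; gcongr
    rw [lo 2 2, up 2 3, up 2 4, up 3 2, up 3 3, up 3 4, up 4 2, up 4 3, up 4 4,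
      a2, q2]
    · ring
    all_goals first | (constructor <;> norm_num) | linarith
  · have := le_of h3
    have h7 := lt_of (by positivity) h7
    rw [s7] at h7
    rw [lo 2 2, lo 2 3, up 2 4, lo 3 2, up 3 3, up 3 4, up 4 2, up 4 3, up 4 4,
      a2, q2, a3, q3]
    · ring_nf
    all_goals first | (constructor <;> norm_num) | linarith
  · have := le_of h12
    rw [s12] at this
    have h3 := lt_of (by positivity) h3
    rw [lo 2 2, lo 2 3, up 2 4, lo 3 2, lo 3 3, up 3 4, up 4 2, up 4 3, up 4 4,
      a2, q2, a3, q3]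
    · ring_nf
    all_goals first | (constructor <;> norm_num) | linarith
  · have := le_of h13
    have h12 := lt_of (by positivity) h12
    rw [s13] at this
    rw [s12] at h12
    rw [lo 2 2, lo 2 3, lo 2 4, lo 3 2, lo 3 3, up 3 4, lo 4 2, up 4 3, up 4 4,
      a2, q2, a3, q3, a4, q4]
    · ring_nf
    all_goals first | (constructor <;> norm_num) | linarith
  · have := le_of h4
    have h13 := lt_of (by positivity) h13
    rw [s13] at h13
    rw [lo 2 2, lo 2 3, lo 2 4, lo 3 2, lo 3 3, lo 3 4, lo 4 2, lo 4 3, up 4 4,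
      a2, q2, a3, q3, a4, q4]
    · ring_nf
    all_goals first | (constructor <;> norm_num) | linarith
  -- Beyond 4 all nine formulas are active and cancel: each of their terms is affine in `i` or in
  -- `j`, and the weights $1,-2,1$ annihilate affine functions.
  · have h4 := lt_of (by positivity) h4
    rw [lo 2 2, lo 2 3, lo 2 4, lo 3 2, lo 3 3, lo 3 4, lo 4 2, lo 4 3, lo 4 4]
    · ring
    all_goals first | (constructor <;> norm_num) | linarith

theorem densityAL_of_lt_two {d : ℝ} (hd : d < 2) : densityAL d = 0 := by
  rw [densityAL, if_pos hd, mul_zero]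

theorem densityAL_nonneg (d : ℝ) : 0 ≤ densityAL d := by
  rcases lt_or_ge d 2 with h | h
  · rw [densityAL_of_lt_two h]
  · rw [densityAL_eq_integral (by linarith)]
    have : 0 ≤ ∫ θ in (-Real.pi)..Real.pi, tent (obliqueFst d θ) * tent (obliqueSnd d θ) :=
      intervalIntegral.integral_nonneg (by linarith [Real.pi_pos])
        fun θ _ => mul_nonneg (tent_nonneg _) (tent_nonneg _)
    positivity

/-! ### The rhombuses as affine images of the unit square -/

/-- The linear parametrization of `ℂ` by coordinates with respect to `u * exp (π * I / 3)` and
`u * exp (-π * I / 3)`. -/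
noncomputable def obliqueMap (u : ℂ) : (ℝ × ℝ) →ₗ[ℝ] ℂ where
  toFun p := u * ⟨(p.1 + p.2) / 2, (p.1 - p.2) * √3 / 2⟩
  map_add' p q := by
    rw [← mul_add]; congr 1
    apply Complex.ext <;> simp <;> ring
  map_smul' a p := by
    rw [RingHom.id_apply, ← mul_smul_comm]; congr 1
    apply Complex.ext <;> simp <;> ring

lemma obliqueMap_apply (u : ℂ) (p : ℝ × ℝ) :
    obliqueMap u p = u * ⟨(p.1 + p.2) / 2, (p.1 - p.2) * √3 / 2⟩ := rfl

lemma norm_obliqueMap (u : ℂ) (p : ℝ × ℝ) :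
    ‖obliqueMap u p‖ = ‖u‖ * √(p.1 ^ 2 - p.1 * p.2 + p.2 ^ 2) := by
  rw [obliqueMap_apply, norm_mul]
  congr 1
  rw [Complex.norm_def, Complex.normSq_mk]
  congr 1
  linear_combination (p.1 - p.2) ^ 2 / 4 * sqrt_three_sq

lemma injective_obliqueMap {u : ℂ} (hu : ‖u‖ = 1) : Function.Injective (obliqueMap u) := by
  rw [← LinearMap.ker_eq_bot, LinearMap.ker_eq_bot']
  intro p hp
  have h := norm_obliqueMap u p
  rw [hp, norm_zero, hu, one_mul, eq_comm, Real.sqrt_eq_zero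
    (by nlinarith [sq_nonneg (p.1 - p.2), sq_nonneg (p.1 + p.2)])] at h
  ext
  · have : p.1 ^ 2 = 0 := by nlinarith [sq_nonneg (p.1 - 2 * p.2), sq_nonneg p.1]
    simpa using this
  · have : p.2 ^ 2 = 0 := by nlinarith [sq_nonneg (p.2 - 2 * p.1), sq_nonneg p.2]
    simpa using this

/-- `obliqueMap` as a continuous linear equivalence. -/
noncomputable def obliqueEquiv (u : ℂ) (hu : ‖u‖ = 1) : (ℝ × ℝ) ≃L[ℝ] ℂ :=
  (LinearMap.linearEquivOfInjective (obliqueMap u) (injective_obliqueMap hu)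
    (by simp)).toContinuousLinearEquiv

lemma obliqueEquiv_apply {u : ℂ} (hu : ‖u‖ = 1) (p : ℝ × ℝ) :
    obliqueEquiv u hu p = obliqueMap u p := rfl

/-- The unit square. -/
def unitSquare : Set (ℝ × ℝ) := Icc 0 1 ×ˢ Icc 0 1

lemma measurableSet_unitSquare : MeasurableSet unitSquare := measurableSet_Icc.prod measurableSet_Icc

lemma volume_unitSquare : volume unitSquare = 1 := by
  rw [unitSquare, Measure.volume_eq_prod, Measure.prod_prod]; simp

lemma restrict_unitSquare : (volume.restrict unitSquare : Measure (ℝ × ℝ)) =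
    (volume.restrict (Icc (0 : ℝ) 1)).prod (volume.restrict (Icc (0 : ℝ) 1)) := by
  rw [unitSquare, Measure.volume_eq_prod, Measure.prod_restrict]

/-- Convex hulls commute with products and with affine maps. -/
lemma convexHull_rhombus (z u : ℂ) :
    convexHull ℝ {z, z + obliqueMap u (1, 0), z + obliqueMap u (1, 1), z + obliqueMap u (0, 1)} =
      (fun p => z + obliqueMap u p) '' unitSquare := by
  have h1 : unitSquare = convexHull ℝ (({0, 1} : Set ℝ) ×ˢ ({0, 1} : Set ℝ)) := by
    rw [convexHull_prod, convexHull_pair, segment_eq_Icc zero_le_one, unitSquare]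
  have h2 : (fun p => z + obliqueMap u p) =
      ((AffineMap.const ℝ (ℝ × ℝ) z) + (obliqueMap u).toAffineMap : (ℝ × ℝ) →ᵃ[ℝ] ℂ) := by
    ext p; simp
  rw [h1, h2, AffineMap.image_convexHull]
  congr 1
  rw [← h2, insert_prod, singleton_prod]
  simp only [image_union, image_pair]
  have : obliqueMap u (0, 0) = 0 := map_zero _
  rw [this, add_zero]
  ext w; simp only [mem_insert_iff, mem_singleton_iff, mem_union]; tauto

lemma hexVertex_zero (c w : ℂ) : hexVertex c w 0 = c + obliqueMap w (1, 1) := by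
  have : (⟨(1 + 1) / 2, (1 - 1) * √3 / 2⟩ : ℂ) = 1 := by apply Complex.ext <;> simp
  rw [hexVertex, obliqueMap_apply, this]; simp

lemma hexVertex_one (c w : ℂ) : hexVertex c w 1 = c + obliqueMap w (1, 0) := by
  rw [hexVertex, obliqueMap_apply]
  congr 2
  rw [Int.cast_one, one_mul, Complex.exp_mul_I]
  rw [← Complex.ofReal_cos, ← Complex.ofReal_sin, Real.cos_pi_div_three, Real.sin_pi_div_three]
  apply Complex.ext <;> simp

lemma hexVertex_neg_one (c w : ℂ) : hexVertex c w (-1) = c + obliqueMap w (0, 1) := by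
  rw [hexVertex, obliqueMap_apply]
  congr 2
  rw [Int.cast_neg, Int.cast_one, neg_one_mul, neg_div, Complex.exp_mul_I]
  rw [← Complex.ofReal_cos, ← Complex.ofReal_sin, Real.cos_neg, Real.sin_neg,
    Real.cos_pi_div_three, Real.sin_pi_div_three]
  apply Complex.ext <;> simp; ring

lemma rhombusL_eq (c u : ℂ) :
    rhombusL c u = (fun p => c - u + obliqueMap (-u) p) '' unitSquare := by
  rw [rhombusL, hexVertex_zero, hexVertex_one, hexVertex_neg_one, ← convexHull_rhombus]
  congr 1
  ext w; simp only [mem_insert_iff, mem_singleton_iff]; tauto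

lemma rhombusA_eq (c u : ℂ) :
    rhombusA c u = (fun p => c + u + obliqueMap u p) '' unitSquare := by
  rw [rhombusA, hexVertex_zero, hexVertex_one, hexVertex_neg_one, ← convexHull_rhombus]
  have e1 : c + obliqueMap (2 * u) (1, 1) = c + u + obliqueMap u (1, 1) := by
    have : (⟨(1 + 1) / 2, (1 - 1) * √3 / 2⟩ : ℂ) = 1 := by apply Complex.ext <;> simp
    simp only [obliqueMap_apply, this]; ring
  have e2 : midpoint ℝ (c + obliqueMap (2 * u) (1, 1)) (c + obliqueMap (2 * u) (1, 0)) =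
      c + u + obliqueMap u (1, 0) := by
    rw [e1, midpoint_eq_smul_add]
    simp only [obliqueMap_apply]
    apply Complex.ext <;> simp <;> ring
  have e3 : midpoint ℝ (c + obliqueMap (2 * u) (1, 1)) (c + obliqueMap (2 * u) (0, 1)) =
      c + u + obliqueMap u (0, 1) := by
    rw [e1, midpoint_eq_smul_add]
    simp only [obliqueMap_apply]
    apply Complex.ext <;> simp <;> ring
  rw [e2, e3, e1]
  congr 1
  ext w; simp only [mem_insert_iff, mem_singleton_iff]; tauto

/-! ### Uniform laws in coordinates and their sums -/

/-- By uniqueness of Haar measure, the coordinate map carries Lebesgue measure to a multiple `k` of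
Lebesgue measure. The constant cancels on normalization, so its value is not needed. -/
theorem map_coordinates_of_isUniform {Ω : Type*} [MeasurableSpace Ω] {P : Measure Ω} {X : Ω → ℂ}
    (e : (ℝ × ℝ) ≃L[ℝ] ℂ) (z : ℂ)
    (hX : pdf.IsUniform X ((fun p => z + e p) '' unitSquare) P volume) :
    AEMeasurable X P ∧
      P.map (fun ω => e.symm (X ω - z)) = volume.restrict unitSquare := by
  set Φ : ℂ → ℝ × ℝ := fun w => e.symm (w - z) with hΦ
  have hΦm : Measurable Φ := by
    apply Continuous.measurable; fun_prop
  have himg : (fun p => z + e p) '' unitSquare = Φ ⁻¹' unitSquare := by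
    ext w
    constructor
    · rintro ⟨p, hp, rfl⟩; simpa [hΦ] using hp
    · intro hw; exact ⟨Φ w, hw, by simp [hΦ]⟩
  have hmap : (volume : Measure ℂ).map Φ = (volume : Measure ℂ).map e.symm := by
    have : Φ = e.symm ∘ (fun w => w - z) := rfl
    rw [this, ← Measure.map_map e.symm.continuous.measurable (by fun_prop),
      map_sub_right_eq_self]
  have hk := Measure.isAddLeftInvariant_eq_smul
    ((volume : Measure ℂ).map e.symm) (volume : Measure (ℝ × ℝ))
  have hk0 := Measure.addHaarScalarFactor_pos_of_isAddHaarMeasure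
    ((volume : Measure ℂ).map e.symm) (volume : Measure (ℝ × ℝ))
  set k := Measure.addHaarScalarFactor ((volume : Measure ℂ).map e.symm)
    (volume : Measure (ℝ × ℝ))
  have hk0 : (k : ENNReal) ≠ 0 := ENNReal.coe_ne_zero.2 hk0.ne'
  have hkt : (k : ENNReal) ≠ ⊤ := ENNReal.coe_ne_top
  replace hk : (volume : Measure ℂ).map e.symm = (k : ENNReal) • (volume : Measure (ℝ × ℝ)) := hk
  rw [hk] at hmap
  rw [himg] at hX
  have hvol : volume (Φ ⁻¹' unitSquare) = k := by
    rw [← Measure.map_apply hΦm measurableSet_unitSquare, hmap, Measure.smul_apply,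
      volume_unitSquare, smul_eq_mul, mul_one]
  -- The set has positive finite measure, so the uniform law is nonzero; the pushforward by a map
  -- that is not a.e. measurable would be zero.
  have hXm : AEMeasurable X P := hX.aemeasurable (by rwa [hvol]) (by rwa [hvol])
  refine ⟨hXm, ?_⟩
  change P.map (Φ ∘ X) = _
  rw [← AEMeasurable.map_map_of_aemeasurable hΦm.aemeasurable hXm, hX, ProbabilityTheory.cond, hvol,
    Measure.map_smul, ← Measure.restrict_map hΦm measurableSet_unitSquare, hmap,
    Measure.restrict_smul, smul_smul, ENNReal.inv_mul_cancel hk0 hkt, one_smul]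

/-- Substituting $a=2+p+q$ for fixed $p$ and exchanging the integrals leaves the length of
$[0,1]\cap[a-3,a-2]$, which is `tent a`. -/
theorem lintegral_add_of_uniform {g : ℝ → ENNReal} (hg : Measurable g) :
    ∫⁻ p in Icc (0 : ℝ) 1, ∫⁻ q in Icc (0 : ℝ) 1, g (2 + (p + q)) =
      ∫⁻ a, ENNReal.ofReal (tent a) * g a := by
  have inner : ∀ p : ℝ, ∫⁻ q in Icc (0 : ℝ) 1, g (2 + (p + q)) =
      ∫⁻ a, (Icc (a - 3) (a - 2)).indicator 1 p * g a := by
    intro p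
    rw [← lintegral_indicator measurableSet_Icc,
      ← lintegral_add_right_eq_self (fun a => (Icc (a - 3) (a - 2)).indicator 1 p * g a) (2 + p)]
    refine lintegral_congr fun q => ?_
    rw [show q + (2 + p) = 2 + (p + q) by ring]
    by_cases hq : q ∈ Icc (0 : ℝ) 1
    · rw [indicator_of_mem hq, indicator_of_mem, Pi.one_apply, one_mul]
      exact ⟨by linarith [hq.2], by linarith [hq.1]⟩
    · rw [indicator_of_notMem hq, indicator_of_notMem, zero_mul]
      exact fun h => hq ⟨by linarith [h.2], by linarith [h.1]⟩
  simp_rw [inner]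
  have hset : MeasurableSet {x : ℝ × ℝ | x.1 ∈ Icc (x.2 - 3) (x.2 - 2)} :=
    (measurableSet_le (f := fun x : ℝ × ℝ => x.2 - 3) (by fun_prop) measurable_fst).inter
      (measurableSet_le (g := fun x : ℝ × ℝ => x.2 - 2) measurable_fst (by fun_prop))
  have hm : Measurable fun x : ℝ × ℝ => (Icc (x.2 - 3) (x.2 - 2)).indicator (1 : ℝ → ENNReal) x.1 :=
    (measurable_one.indicator hset : Measurable
      ({x : ℝ × ℝ | x.1 ∈ Icc (x.2 - 3) (x.2 - 2)}.indicator (1 : ℝ × ℝ → ENNReal)))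
  rw [lintegral_lintegral_swap (hm.mul (hg.comp measurable_snd)).aemeasurable]
  refine lintegral_congr fun a => ?_
  rw [lintegral_mul_const _ (measurable_one.indicator measurableSet_Icc),
    lintegral_indicator_one measurableSet_Icc, Measure.restrict_apply measurableSet_Icc,
    Icc_inter_Icc, Real.volume_Icc]
  have : tent a = max 0 (min (a - 2) 1 - max (a - 3) 0) := by
    rw [tent, min_comm 1, max_comm 0 (a - 3)]
  rw [this, ENNReal.ofReal_max, ENNReal.ofReal_zero, max_eq_right (a := (0 : ENNReal)) (by simp)]

theorem lintegral_add_of_uniform_square {H : ℝ × ℝ → ENNReal} (hH : Measurable H) :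
    ∫⁻ w, H (2 + (w.1.1 + w.2.1), 2 + (w.1.2 + w.2.2))
        ∂((volume.restrict unitSquare).prod (volume.restrict unitSquare)) =
      ∫⁻ v, ENNReal.ofReal (tent v.1) * ENNReal.ofReal (tent v.2) * H v := by
  have ht := continuous_tent.measurable
  rw [lintegral_prod _ (by fun_prop), restrict_unitSquare, lintegral_prod _ (by
    apply Measurable.aemeasurable
    exact Measurable.lintegral_prod_right' (f := fun w : (ℝ × ℝ) × (ℝ × ℝ) =>
      H (2 + (w.1.1 + w.2.1), 2 + (w.1.2 + w.2.2))) (by fun_prop))]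
  calc _ = ∫⁻ p₁ in Icc (0 : ℝ) 1, ∫⁻ p₂ in Icc (0 : ℝ) 1, ∫⁻ q₁ in Icc (0 : ℝ) 1,
        ∫⁻ q₂ in Icc (0 : ℝ) 1, H (2 + (p₁ + q₁), 2 + (p₂ + q₂)) := by
        refine lintegral_congr fun p₁ => lintegral_congr fun p₂ => ?_
        rw [lintegral_prod _ (by fun_prop)]
    -- Exchanging the two middle integrals pairs the variables by coordinate, so that the
    -- one-dimensional lemma applies twice.
    _ = ∫⁻ p₁ in Icc (0 : ℝ) 1, ∫⁻ q₁ in Icc (0 : ℝ) 1, ∫⁻ p₂ in Icc (0 : ℝ) 1,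
        ∫⁻ q₂ in Icc (0 : ℝ) 1, H (2 + (p₁ + q₁), 2 + (p₂ + q₂)) := by
        refine lintegral_congr fun p₁ => ?_
        rw [lintegral_lintegral_swap]
        apply Measurable.aemeasurable
        exact Measurable.lintegral_prod_right' (f := fun w : (ℝ × ℝ) × ℝ =>
          H (2 + (p₁ + w.1.2), 2 + (w.1.1 + w.2))) (by fun_prop)
    _ = ∫⁻ p₁ in Icc (0 : ℝ) 1, ∫⁻ q₁ in Icc (0 : ℝ) 1,
        (fun a => ∫⁻ b, ENNReal.ofReal (tent b) * H (a, b)) (2 + (p₁ + q₁)) := by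
        refine lintegral_congr fun p₁ => lintegral_congr fun q₁ => ?_
        exact lintegral_add_of_uniform (g := fun b => H (2 + (p₁ + q₁), b)) (by fun_prop)
    _ = _ := by
        rw [lintegral_add_of_uniform (Measurable.lintegral_prod_right'
          (f := fun v : ℝ × ℝ => ENNReal.ofReal (tent v.2) * H v) (by fun_prop)),
          Measure.volume_eq_prod, lintegral_prod _ (by fun_prop)]
        refine lintegral_congr fun a => ?_
        rw [← lintegral_const_mul _ (by fun_prop)]
        simp only [mul_assoc]

/-! ### Polar integration in oblique coordinates -/

/-- The linear map that sends a point of the plane to its oblique coordinates. -/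
noncomputable def obliqueCoord : (ℝ × ℝ) →ₗ[ℝ] ℝ × ℝ :=
  Matrix.toLin (Module.Basis.finTwoProd ℝ) (Module.Basis.finTwoProd ℝ) !![1, 1 / √3; 1, -1 / √3]

lemma obliqueCoord_apply (p : ℝ × ℝ) :
    obliqueCoord p = (p.1 + p.2 / √3, p.1 - p.2 / √3) := by
  rw [obliqueCoord, Matrix.toLin_finTwoProd_apply]
  ext <;> simp <;> ring

lemma det_obliqueCoord : LinearMap.det obliqueCoord = -(2 / √3) := by
  rw [obliqueCoord, LinearMap.det_toLin, Matrix.det_fin_two_of]; ring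

/-- The factor $2/\sqrt3$ is the absolute determinant of `obliqueCoord`, and `r` is the polar
Jacobian. -/
theorem lintegral_eq_lintegral_oblique {K : ℝ × ℝ → ENNReal} (hK : Measurable K) :
    ∫⁻ v, K v = ENNReal.ofReal (2 / √3) * ∫⁻ r in Ioi (0 : ℝ),
      ∫⁻ θ in Ioo (-Real.pi) Real.pi,
        ENNReal.ofReal r * K (obliqueFst r θ, obliqueSnd r θ) := by
  have hpos : 0 < 2 / √(3 : ℝ) := by positivity
  have hL : Measurable obliqueCoord := obliqueCoord.continuous_of_finiteDimensional.measurable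
  have hmap := Measure.map_linearMap_addHaar_eq_smul_addHaar (volume : Measure (ℝ × ℝ))
    (f := obliqueCoord) (by rw [det_obliqueCoord]; exact (neg_neg_of_pos hpos).ne)
  rw [det_obliqueCoord, abs_inv, abs_neg, abs_of_pos hpos, ENNReal.ofReal_inv_of_pos hpos] at hmap
  have h1 : ∫⁻ w, K (obliqueCoord w) = (ENNReal.ofReal (2 / √3))⁻¹ * ∫⁻ v, K v := by
    rw [← lintegral_map hK hL, hmap, lintegral_smul_measure, smul_eq_mul]
  have h2 : ∫⁻ v, K v = ENNReal.ofReal (2 / √3) * ∫⁻ w, K (obliqueCoord w) := by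
    rw [h1, ← mul_assoc, ENNReal.mul_inv_cancel (by simp) ENNReal.ofReal_ne_top,
      one_mul]
  have hf1 : Measurable fun p : ℝ × ℝ => obliqueFst p.1 p.2 := by unfold obliqueFst; fun_prop
  have hf2 : Measurable fun p : ℝ × ℝ => obliqueSnd p.1 p.2 := by unfold obliqueSnd; fun_prop
  rw [h2, ← lintegral_comp_polarCoord_symm, polarCoord_target, Measure.volume_eq_prod,
    ← Measure.prod_restrict]
  have h3 : ∀ p : ℝ × ℝ, ENNReal.ofReal p.1 • K (obliqueCoord (polarCoord.symm p)) =
      ENNReal.ofReal p.1 * K (obliqueFst p.1 p.2, obliqueSnd p.1 p.2) := by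
    intro p
    rw [obliqueCoord_apply]; rfl
  simp_rw [h3]
  rw [lintegral_prod _ (by fun_prop)]

theorem lintegral_tent_mul_norm {φ : ℝ → ENNReal} (hφ : Measurable φ) :
    ∫⁻ v : ℝ × ℝ, ENNReal.ofReal (tent v.1) * ENNReal.ofReal (tent v.2) *
        φ (√(v.1 ^ 2 - v.1 * v.2 + v.2 ^ 2)) =
      ∫⁻ d, ENNReal.ofReal (densityAL d) * φ d := by
  have ht := continuous_tent
  rw [lintegral_eq_lintegral_oblique (by fun_prop), ← lintegral_const_mul' _ _ ENNReal.ofReal_ne_top,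
    ← setLIntegral_univ (fun d => ENNReal.ofReal (densityAL d) * φ d),
    ← lintegral_indicator measurableSet_Ioi, setLIntegral_univ]
  refine lintegral_congr fun r => ?_
  by_cases hr : r ∈ Ioi (0 : ℝ)
  swap
  · rw [indicator_of_notMem hr, densityAL_of_lt_two (by have := notMem_Ioi.1 hr; linarith)]
    simp
  rw [indicator_of_mem hr]
  have hr : 0 < r := hr
  have hc1 := continuous_obliqueFst r
  have hc2 := continuous_obliqueSnd r
  -- The norm is constant on the circle, so `φ r` leaves the integral over the angle.
  have h1 : ∀ θ, ENNReal.ofReal r * (ENNReal.ofReal (tent (obliqueFst r θ)) *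
      ENNReal.ofReal (tent (obliqueSnd r θ)) *
      φ (√(obliqueFst r θ ^ 2 - obliqueFst r θ * obliqueSnd r θ + obliqueSnd r θ ^ 2))) =
      ENNReal.ofReal (tent (obliqueFst r θ) * tent (obliqueSnd r θ)) *
        (ENNReal.ofReal r * φ r) := by
    intro θ
    rw [oblique_norm_sq, Real.sqrt_sq hr.le, ENNReal.ofReal_mul (tent_nonneg _)]
    ring
  simp_rw [h1]
  rw [lintegral_mul_const _ (by fun_prop), ← ofReal_integral_eq_lintegral_ofReal
    ((Continuous.integrableOn_Icc (by fun_prop)).mono_set Ioo_subset_Icc_self)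
    (Filter.Eventually.of_forall fun θ => mul_nonneg (tent_nonneg _) (tent_nonneg _)),
    ← integral_Ioc_eq_integral_Ioo, ← intervalIntegral.integral_of_le (by linarith [Real.pi_pos]),
    densityAL_eq_integral hr, ← mul_assoc, ← mul_assoc, ← ENNReal.ofReal_mul (by positivity),
    ← ENNReal.ofReal_mul]
  · congr 2; ring
  · have := intervalIntegral.integral_nonneg (μ := volume) (a := -Real.pi) (b := Real.pi)
      (f := fun θ => tent (obliqueFst r θ) * tent (obliqueSnd r θ)) (by linarith [Real.pi_pos])
      fun θ _ => mul_nonneg (tent_nonneg _) (tent_nonneg _)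
    positivity

/-! ### The law of the distance -/

theorem mainTheorem9 {Ω : Type*} [MeasurableSpace Ω]
    (P : MeasureTheory.Measure Ω) [MeasureTheory.IsProbabilityMeasure P]
    (c u : ℂ) (hu : ‖u‖ = 1) (X Y : Ω → ℂ)
    (hX : MeasureTheory.pdf.IsUniform X (rhombusA c u) P MeasureTheory.volume)
    (hY : MeasureTheory.pdf.IsUniform Y (rhombusL c u) P MeasureTheory.volume)
    (hXY : ProbabilityTheory.IndepFun X Y P) :
    (∀ d : ℝ, 0 ≤ densityAL d) ∧
      P.map (fun ω => dist (X ω) (Y ω)) =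
        MeasureTheory.volume.withDensity (fun d : ℝ => ENNReal.ofReal (densityAL d)) := by
  refine ⟨densityAL_nonneg, ?_⟩
  have hu' : ‖-u‖ = 1 := by rwa [norm_neg]
  rw [rhombusA_eq] at hX
  rw [rhombusL_eq] at hY
  obtain ⟨hXm, hU⟩ := map_coordinates_of_isUniform (obliqueEquiv u hu) (c + u) hX
  obtain ⟨hYm, hV⟩ := map_coordinates_of_isUniform (obliqueEquiv (-u) hu') (c - u) hY
  have hm : ∀ (e : (ℝ × ℝ) ≃L[ℝ] ℂ) (z : ℂ), Measurable fun w => e.symm (w - z) := fun e z =>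
    Continuous.measurable (by fun_prop)
  set U : Ω → ℝ × ℝ := fun ω => (obliqueEquiv u hu).symm (X ω - (c + u)) with hUdef
  set V : Ω → ℝ × ℝ := fun ω => (obliqueEquiv (-u) hu').symm (Y ω - (c - u)) with hVdef
  have hUm : AEMeasurable U P := (hm _ _).comp_aemeasurable hXm
  have hVm : AEMeasurable V P := (hm _ _).comp_aemeasurable hYm
  have hUV : P.map (fun ω => (U ω, V ω)) =
      (volume.restrict unitSquare).prod (volume.restrict unitSquare) := by
    rw [(ProbabilityTheory.indepFun_iff_map_prod_eq_prod_map_map hUm hVm).1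
      (hXY.comp (hm (obliqueEquiv u hu) (c + u)) (hm (obliqueEquiv (-u) hu') (c - u))), hU, hV]
  let N : ℝ × ℝ → ℝ := fun v => √(v.1 ^ 2 - v.1 * v.2 + v.2 ^ 2)
  let S : (ℝ × ℝ) × (ℝ × ℝ) → ℝ × ℝ := fun w => (2 + (w.1.1 + w.2.1), 2 + (w.1.2 + w.2.2))
  have hN : Measurable N := by fun_prop
  have hS : Measurable S := by fun_prop
  have hdist : (fun ω => dist (X ω) (Y ω)) = (N ∘ S) ∘ fun ω => (U ω, V ω) := by
    ext ω
    have hx : X ω = c + u + obliqueMap u (U ω) := by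
      rw [← obliqueEquiv_apply hu, hUdef, ContinuousLinearEquiv.apply_symm_apply]; ring
    have hy : Y ω = c - u + obliqueMap (-u) (V ω) := by
      rw [← obliqueEquiv_apply hu', hVdef, ContinuousLinearEquiv.apply_symm_apply]; ring
    -- The parameter `-u` for the second rhombus turns the difference into a sum of coordinates; the
    -- shift 2 comes from $(c+u)-(c-u)=2u$, which has coordinates $(2,2)$.
    have hxy : X ω - Y ω = obliqueMap u (S (U ω, V ω)) := by
      rw [hx, hy]
      simp only [obliqueMap_apply, S]
      apply Complex.ext <;> simp <;> ring
    rw [dist_eq_norm, hxy, norm_obliqueMap, hu, one_mul]; rfl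
  rw [hdist, ← AEMeasurable.map_map_of_aemeasurable (hN.comp hS).aemeasurable
    (hUm.prodMk hVm), hUV]
  ext B hB
  rw [← lintegral_indicator_one hB, lintegral_map (measurable_one.indicator hB) (hN.comp hS),
    withDensity_apply _ hB, ← lintegral_indicator hB]
  -- Two measures are compared on a measurable set `B` by integrating its indicator composed with
  -- the norm.
  have h1 := lintegral_add_of_uniform_square (H := fun v => B.indicator 1 (N v))
    ((measurable_one.indicator hB).comp hN)
  rw [lintegral_tent_mul_norm (measurable_one.indicator hB)] at h1
  refine h1.trans (lintegral_congr fun d => ?_)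
  by_cases hd : d ∈ B <;> simp [hd]
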